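/- Theorem. For a real $n\times m$ matrix $X$ and $r\in\mathbb{N}$, let $X_{[r]}\in\mathbb{R}^{\binom nr\times\binom mr}$ denote the $r$-th multiplicative compound matrix of $X$, whose rows and columns are indexed by the strictly increasing $r$-tuples $I$ from $\{1,\dots,n\}$ and $J$ from $\{1,\dots,m\}$ (in lexicographic order) and whose $(I,J)$ entry is the minor $\det X_{I,J}$. For a vector $v\neq 0$, let $S^-(v)$ be the number of sign changes in the sequence obtained from $v$ by deleting all zero entries, i.e. the number of pairs of consecutive entries of that sequence with negative product; and let $S^-(0):=-1$. Let $X\in\mathbb{R}^{n\times m}$ with $n>m$ and let $k=\operatorname{rank}X<m$. Then the following are equivalent: (i) In each column of $X_{[k]}$ all entries have the same sign in the weak sense: for each $J$, either $\det X_{I,J}\ge 0$ for all $I$, or $\det X_{I,J}\le 0$ for all $I$ (the sign may depend on $J$). (ii) $S^-(Xu)\le k-1$ for every $u\in\mathbb{R}^m$. -/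

import Mathlib

/-- The `r`-th multiplicative compound matrix of `X`: its rows and columns are indexed by the
strictly increasing `r`-tuples of row indices and of column indices of `X`, and its `(I, J)` entry
is the `r`-minor `det X_{I,J}`. -/
noncomputable def compoundMatrix {n m : ℕ} (X : Matrix (Fin n) (Fin m) ℝ) (r : ℕ) :
    Matrix (Fin r ↪o Fin n) (Fin r ↪o Fin m) ℝ :=
  Matrix.of fun I J => (X.submatrix I J).det

/-- The list of the nonzero entries of `u`, in their original order. -/
noncomputable def nonzeroEntries {n : ℕ} (u : Fin n → ℝ) : List ℝ :=
  (List.ofFn u).filter (fun x => x ≠ 0)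

/-- The variation `S⁻(u)`: the number of pairs of adjacent entries with negative product that
remain after all zeros of `u` have been deleted; the zero vector has variation `-1`. -/
noncomputable def signVariation {n : ℕ} (u : Fin n → ℝ) : ℤ :=
  if u = 0 then -1
  else (((nonzeroEntries u).zip (nonzeroEntries u).tail).countP (fun p => p.1 * p.2 < 0) : ℕ)

/-! `S⁻(v) ≥ k` means that `v` alternates in sign along `k + 1` indices
(`natCast_le_signVariation_iff`). For a `(k+1) × k` matrix `T` with deleted-row minors `d p`, every
`x = T c` satisfies `∑ (-1)^p x_p d_p = 0`, and conversely if some `d p ≠ 0`. (i) ⇒ (ii): write `X u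
= A c` with `A` a column basis of `X`. If `A c` alternated on `k + 1` rows, all terms of this
relation would have one weak sign, a contradiction once one minor is nonzero. If all vanish, small
multiples of rows are added to adjacent rows: this keeps the weak signs and the alternation, and
carries a nonzero minor to the chosen rows (`not_alternatesOn_of_minors`). (ii) ⇒ (i): if a column
of the compound has entries of both signs, basis exchange yields two row sets of opposite sign
differing in one row. On their union some `d p` have opposite signs, so the relation has an
alternating solution (`exists_alternatesOn_of_minors`). -/

/-- `x` takes nonzero values of strictly alternating signs along `t`. -/
def AlternatesOn {N k : ℕ} (x : Fin N → ℝ) (t : Fin k ↪o Fin N) : Prop :=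
  ∃ σ : ℝ, ∀ p : Fin k, 0 < σ * (-1) ^ (p : ℕ) * x (t p)

/-! ### Sign changes and alternating subsequences -/

/-- The number of adjacent pairs of entries of a list with negative product. -/
noncomputable def signChanges (l : List ℝ) : ℕ :=
  (l.zip l.tail).countP (fun p => p.1 * p.2 < 0)

theorem signChanges_cons_cons (a b : ℝ) (l : List ℝ) :
    signChanges (a :: b :: l) = signChanges (b :: l) + if a * b < 0 then 1 else 0 := by
  simp [signChanges, List.countP_cons]

theorem mul_neg_iff_of_not_mul_neg {a b c : ℝ} (ha : a ≠ 0) (hb : b ≠ 0) (hab : ¬ a * b < 0) :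
    a * c < 0 ↔ b * c < 0 := by
  have h : 0 < a * b := lt_of_le_of_ne (not_lt.1 hab) (mul_ne_zero ha hb).symm
  rcases pos_and_pos_or_neg_and_neg_of_mul_pos h with ⟨h1, h2⟩ | ⟨h1, h2⟩
  · simp [mul_neg_iff, h1, h2, not_lt.2 h1.le, not_lt.2 h2.le]
  · simp [mul_neg_iff, h1, h2, not_lt.2 h1.le, not_lt.2 h2.le]

theorem exists_isChain_sublist (l : List ℝ) (a : ℝ) (hl : ∀ x ∈ a :: l, x ≠ 0) :
    ∃ l' : List ℝ, (a :: l').Sublist (a :: l) ∧ (a :: l').IsChain (fun x y => x * y < 0) ∧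
      l'.length = signChanges (a :: l) := by
  induction l generalizing a with
  | nil => exact ⟨[], by simp [signChanges]⟩
  | cons b l ih =>
    obtain ⟨l', h1, h2, h3⟩ := ih b fun x hx => hl x (List.mem_cons_of_mem _ hx)
    rw [signChanges_cons_cons]
    by_cases hab : a * b < 0
    · exact ⟨b :: l', h1.cons_cons a, List.isChain_cons_cons.2 ⟨hab, h2⟩, by simp [hab, h3]⟩
    · refine ⟨l', ((List.cons_sublist_cons.1 h1).cons b).cons_cons a, ?_, by simp [hab, h3]⟩
      cases l' with
      | nil => simp
      | cons c l'' =>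
        rw [List.isChain_cons_cons] at h2 ⊢
        exact ⟨(mul_neg_iff_of_not_mul_neg (hl a (by simp)) (hl b (by simp)) hab).2 h2.1, h2.2⟩

/-- The second conjunct strengthens the induction: a chain starting with the sign opposite to the
head costs one further change. -/
theorem length_le_of_isChain_sublist (l : List ℝ) (a : ℝ) (hl : ∀ x ∈ a :: l, x ≠ 0)
    (c : ℝ) (l' : List ℝ) (hs : (c :: l').Sublist (a :: l))
    (hc : (c :: l').IsChain (fun x y => x * y < 0)) :
    l'.length ≤ signChanges (a :: l) ∧ (a * c < 0 → l'.length + 1 ≤ signChanges (a :: l)) := by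
  induction l generalizing a c l' with
  | nil =>
    obtain ⟨rfl, h⟩ | h := List.cons_sublist_cons'.1 hs |>.symm
    · have := List.sublist_nil.1 h
      subst this
      exact ⟨by simp, fun h => absurd h (not_lt.2 (mul_self_nonneg _))⟩
    · simp at h
  | cons b l ih =>
    have hl' : ∀ x ∈ b :: l, x ≠ 0 := fun x hx => hl x (List.mem_cons_of_mem _ hx)
    rw [signChanges_cons_cons]
    obtain h | ⟨rfl, h⟩ := List.cons_sublist_cons'.1 hs
    · obtain ⟨h1, h2⟩ := ih b hl' c l' h hc
      by_cases hab : a * b < 0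
      · simp only [hab, if_true]
        exact ⟨by omega, fun _ => by omega⟩
      · simp only [hab, if_false]
        exact ⟨h1, fun hh =>
          h2 ((mul_neg_iff_of_not_mul_neg (hl a (by simp)) (hl b (by simp)) hab).1 hh)⟩
    · refine ⟨?_, fun h => absurd h (not_lt.2 (mul_self_nonneg _))⟩
      cases l' with
      | nil => simp
      | cons d l'' =>
        rw [List.isChain_cons_cons] at hc
        obtain ⟨h1, h2⟩ := ih b hl' d l'' h hc.2
        by_cases hab : c * b < 0
        · simp only [hab, if_true, List.length_cons]
          omega
        · simp only [hab, if_false, List.length_cons]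
          exact h2 ((mul_neg_iff_of_not_mul_neg (hl c (by simp)) (hl b (by simp)) hab).1 hc.1)

theorem exists_isChain_sublist_iff (l : List ℝ) (hl : ∀ x ∈ l, x ≠ 0) (k : ℕ) :
    (∃ l' : List ℝ, l'.Sublist l ∧ l'.IsChain (fun x y => x * y < 0) ∧ l'.length = k + 1) ↔
      l ≠ [] ∧ k ≤ signChanges l := by
  cases l with
  | nil =>
    simp only [List.sublist_nil, ne_eq, not_true_eq_false, false_and, iff_false]
    rintro ⟨_, rfl, -, h⟩
    simp at h
  | cons a l =>
    constructor
    · rintro ⟨l', hs, hc, hk⟩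
      cases l' with
      | nil => simp at hk
      | cons c l' =>
        have := (length_le_of_isChain_sublist l a hl c l' hs hc).1
        simp only [List.length_cons] at hk
        exact ⟨by simp, by omega⟩
    · rintro ⟨-, hk⟩
      obtain ⟨l', h1, h2, h3⟩ := exists_isChain_sublist l a hl
      exact ⟨(a :: l').take (k + 1), (List.take_sublist _ _).trans h1, h2.take _, by simp; omega⟩

theorem isChain_ofFn_iff_alternates {k : ℕ} (y : Fin (k + 1) → ℝ) (h0 : ∀ p, y p ≠ 0) :
    (List.ofFn y).IsChain (fun a b => a * b < 0) ↔
      ∃ σ : ℝ, ∀ p : Fin (k + 1), 0 < σ * (-1) ^ (p : ℕ) * y p := by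
  rw [List.isChain_ofFn]
  constructor
  · intro h
    refine ⟨y 0, fun ⟨p, hp⟩ => ?_⟩
    induction p with
    | zero => simpa using mul_self_pos.2 (h0 0)
    | succ p ih =>
      have h1 := ih (by omega)
      have h2 := h p hp
      have h3 : 0 < (y 0 * (-1) ^ p * y ⟨p, by omega⟩) * -(y ⟨p, by omega⟩ * y ⟨p + 1, hp⟩) :=
        mul_pos h1 (by linarith)
      have h4 : 0 < y ⟨p, by omega⟩ ^ 2 := by have := h0 ⟨p, by omega⟩; positivity
      refine pos_of_mul_pos_left (b := y ⟨p, by omega⟩ ^ 2) ?_ h4.le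
      rw [pow_succ (-1 : ℝ) p]
      linarith
  · rintro ⟨σ, h⟩ i hi
    have h1 := mul_pos (h ⟨i, by omega⟩) (h ⟨i + 1, hi⟩)
    simp only [pow_succ] at h1
    have h2 : ((-1 : ℝ) ^ i) * (-1) ^ i = 1 := by rw [← mul_pow]; simp
    have h3 : 0 < -(y ⟨i, by omega⟩ * y ⟨i + 1, hi⟩) := by
      refine pos_of_mul_pos_right (a := σ ^ 2) ?_ (sq_nonneg σ)
      convert h1 using 1
      linear_combination (-(σ ^ 2) * y ⟨i, by omega⟩ * y ⟨i + 1, hi⟩) * h2.symm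
    linarith

theorem exists_alternatesOn_iff_sublist {n k : ℕ} (u : Fin n → ℝ) :
    (∃ t : Fin (k + 1) ↪o Fin n, AlternatesOn u t) ↔
      ∃ l' : List ℝ, l'.Sublist (nonzeroEntries u) ∧ l'.IsChain (fun x y => x * y < 0) ∧
        l'.length = k + 1 := by
  constructor
  · rintro ⟨t, ht⟩
    have h0 : ∀ p, (u ∘ t) p ≠ 0 := by
      obtain ⟨σ, hσ⟩ := ht
      exact fun p h => by simpa [show u (t p) = 0 from h] using hσ p
    refine ⟨List.ofFn (u ∘ t), ?_, (isChain_ofFn_iff_alternates _ h0).2 ht, by simp⟩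
    have h1 : (List.ofFn (u ∘ t)).Sublist (List.ofFn u) := by
      rw [List.sublist_iff_exists_fin_orderEmbedding_get_eq]
      refine ⟨((Fin.castOrderIso (List.length_ofFn)).toOrderEmbedding.trans t).trans
        (Fin.castOrderIso (List.length_ofFn).symm).toOrderEmbedding, fun i => ?_⟩
      simp [-List.ofFn_succ]
      rfl
    have h2 := h1.filter (fun x => decide (x ≠ 0))
    rwa [List.filter_eq_self.2] at h2
    intro x hx
    obtain ⟨p, rfl⟩ := (List.mem_ofFn' _ _).1 hx
    simpa using h0 p
  · rintro ⟨l', hs, hc, hk⟩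
    have h0 : ∀ x ∈ l', x ≠ 0 := fun x hx => by
      simpa using (List.mem_filter.1 (hs.subset hx)).2
    have h1 : l'.Sublist (List.ofFn u) := hs.trans List.filter_sublist
    obtain ⟨f, hf⟩ := List.sublist_iff_exists_fin_orderEmbedding_get_eq.1 h1
    let t : Fin (k + 1) ↪o Fin n := ((Fin.castOrderIso hk.symm).toOrderEmbedding.trans f).trans
        (Fin.castOrderIso (List.length_ofFn)).toOrderEmbedding
    have ht : ∀ p, u (t p) = l'.get (Fin.cast hk.symm p) := fun p => by
      rw [hf]
      simp [t]
      rfl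
    have h2 : List.ofFn (u ∘ t) = l' := by
      refine List.ext_get (by simp [hk]) fun i h1 h2 => ?_
      simpa [-List.ofFn_succ] using ht ⟨i, by simpa using h1⟩
    refine ⟨t, (isChain_ofFn_iff_alternates (u ∘ t) fun p => ?_).1 (h2 ▸ hc)⟩
    rw [Function.comp_apply, ht]
    exact h0 _ (List.get_mem _ _)

theorem natCast_le_signVariation_iff {n k : ℕ} (u : Fin n → ℝ) :
    (k : ℤ) ≤ signVariation u ↔ ∃ t : Fin (k + 1) ↪o Fin n, AlternatesOn u t := by
  rw [exists_alternatesOn_iff_sublist, exists_isChain_sublist_iff _ fun x hx => by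
    simpa using (List.mem_filter.1 hx).2]
  have h : nonzeroEntries u = [] ↔ u = 0 := by
    simp [nonzeroEntries, List.filter_eq_nil_iff, funext_iff, List.mem_ofFn]
  rw [signVariation, ne_eq, h]
  -- For `u = 0` the value `-1` excludes even `k = 0`, just as no index alternates.
  split_ifs with h0
  · simp [h0]
    omega
  · simp [h0, signChanges]

/-! ### The linear relation between a column space and its minors -/

open Matrix in
-- Prepending the column `T c` to `T` gives a singular matrix, with `(-1, c)` in its kernel; its
-- determinant is expanded along that column.
theorem sum_alternating_minors_eq_zero {k : ℕ} (T : Matrix (Fin (k + 1)) (Fin k) ℝ)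
    (c : Fin k → ℝ) :
    ∑ p : Fin (k + 1), (-1) ^ (p : ℕ) * (T *ᵥ c) p * (T.submatrix p.succAbove id).det = 0 := by
  let M : Matrix (Fin (k + 1)) (Fin (k + 1)) ℝ := of fun p => Fin.cons ((T *ᵥ c) p) (T p)
  have h1 : M.det = 0 := by
    refine exists_mulVec_eq_zero_iff.1 ⟨Fin.cons (-1) c, ?_, ?_⟩
    · intro h
      simpa using congrFun h 0
    · ext p
      simp [M, mulVec, dotProduct, Fin.sum_univ_succ]
  rw [det_succ_column_zero] at h1
  exact h1

open Matrix in
theorem exists_mulVec_eq_of_sum_alternating_minors {k : ℕ} (T : Matrix (Fin (k + 1)) (Fin k) ℝ)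
    (x : Fin (k + 1) → ℝ)
    (hx : ∑ p : Fin (k + 1), (-1) ^ (p : ℕ) * x p * (T.submatrix p.succAbove id).det = 0)
    (hT : ∃ p : Fin (k + 1), (T.submatrix p.succAbove id).det ≠ 0) :
    ∃ c, T *ᵥ c = x := by
  let M : Matrix (Fin (k + 1)) (Fin (k + 1)) ℝ := of fun p => Fin.cons (x p) (T p)
  have h1 : M.det = 0 := by
    rw [det_succ_column_zero]
    exact hx
  obtain ⟨v, hv, hMv⟩ := exists_mulVec_eq_zero_iff.2 h1
  have h2 : ∀ p, x p * v 0 + (T *ᵥ Fin.tail v) p = 0 := fun p => by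
    have := congrFun hMv p
    simpa [M, mulVec, dotProduct, Fin.sum_univ_succ, Fin.tail] using this
  -- Otherwise the tail of `v` would be a nonzero kernel vector of every deleted-row submatrix.
  have h0 : v 0 ≠ 0 := by
    intro h0
    obtain ⟨p, hp⟩ := hT
    refine hp (exists_mulVec_eq_zero_iff.1 ⟨Fin.tail v, fun h => hv ?_, ?_⟩)
    · ext i
      refine Fin.cases h0 (fun j => congrFun h j) i
    · ext i
      have h3 := h2 (p.succAbove i)
      rw [h0, mul_zero, zero_add] at h3
      exact h3
  refine ⟨(-(v 0)⁻¹) • Fin.tail v, ?_⟩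
  ext p
  rw [mulVec_smul, Pi.smul_apply, smul_eq_mul]
  field_simp
  linarith [h2 p]

/-! ### Increasing tuples, bases and nonzero minors -/

theorem exists_orderEmbedding_range_eq {n k : ℕ} (f : Fin k → Fin n) (hf : f.Injective) :
    ∃ I : Fin k ↪o Fin n, Set.range I = Set.range f := by
  have h : (Finset.univ.image f).card = k := by
    rw [Finset.card_image_of_injective _ hf, Finset.card_fin]
  exact ⟨(Finset.univ.image f).orderEmbOfFin h, by simp⟩

theorem det_submatrix_ne_zero_of_range_eq {n k : ℕ} (A : Matrix (Fin n) (Fin k) ℝ)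
    {f g : Fin k → Fin n} (hf : f.Injective) (h : Set.range g = Set.range f)
    (h0 : (A.submatrix f id).det ≠ 0) : (A.submatrix g id).det ≠ 0 := by
  have h1 : ∀ s, ∃ r, g r = f s := fun s => by
    rw [← Set.mem_range, h]
    exact ⟨s, rfl⟩
  choose π hπ using h1
  have hinj : π.Injective := fun a b hab => hf (by rw [← hπ a, ← hπ b, hab])
  let e : Equiv.Perm (Fin k) := Equiv.ofBijective π (Finite.injective_iff_bijective.1 hinj)
  have h2 : A.submatrix f id = (A.submatrix g id).submatrix e id := by
    ext i j
    simp [e, hπ]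
  rw [h2, Matrix.det_permute] at h0
  exact right_ne_zero_of_mul h0

theorem exists_orderEmbedding_linearIndependent {V : Type*} [AddCommGroup V] [Module ℝ V]
    [FiniteDimensional ℝ V] {N k : ℕ} (v : Fin N → V)
    (hk : Module.finrank ℝ (Submodule.span ℝ (Set.range v)) = k) :
    ∃ J : Fin k ↪o Fin N, LinearIndependent ℝ (v ∘ J) ∧
      Submodule.span ℝ (Set.range (v ∘ J)) = Submodule.span ℝ (Set.range v) := by
  subst hk
  obtain ⟨f, hf, hspan, hli⟩ := Submodule.exists_fun_fin_finrank_span_eq ℝ (Set.range v)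
  choose g hg using hf
  have hg' : v ∘ g = f := funext hg
  obtain ⟨J, hJ⟩ := exists_orderEmbedding_range_eq g
    (fun a b hab => hli.injective (by rw [← hg a, ← hg b, hab]))
  have h1 : Set.range (v ∘ J) = Set.range f := by
    rw [← hg', Set.range_comp, Set.range_comp, hJ]
  have h2 : Submodule.span ℝ (Set.range (v ∘ J)) = Submodule.span ℝ (Set.range v) := by
    rw [h1, hspan]
  refine ⟨J, ?_, h2⟩
  rw [linearIndependent_iff_card_eq_finrank_span, Set.finrank, h2, Fintype.card_fin]

theorem exists_det_submatrix_ne_zero {n k : ℕ} (A : Matrix (Fin n) (Fin k) ℝ)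
    (hA : LinearIndependent ℝ A.col) : ∃ I : Fin k ↪o Fin n, (A.submatrix I id).det ≠ 0 := by
  have hr : A.rank = k := by
    rw [← Matrix.rank_transpose]
    simpa using LinearIndependent.rank_matrix (M := A.transpose) hA
  rw [Matrix.rank_eq_finrank_span_row] at hr
  obtain ⟨I, hI, -⟩ := exists_orderEmbedding_linearIndependent _ hr
  refine ⟨I, ?_⟩
  have h : IsUnit (A.submatrix I id) := Matrix.linearIndependent_rows_iff_isUnit.1 hI
  exact ((Matrix.isUnit_iff_isUnit_det _).1 h).ne_zero

/-! ### Perturbation by adjacent rows -/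

/-- `A` with `ε` times row `a` added to row `b`. -/
noncomputable def addRow {n k : ℕ} (A : Matrix (Fin n) (Fin k) ℝ) (a b : Fin n) (ε : ℝ) :
    Matrix (Fin n) (Fin k) ℝ :=
  A.updateRow b (A b + ε • A a)

theorem det_submatrix_addRow_of_notMem {n k : ℕ} (A : Matrix (Fin n) (Fin k) ℝ) (a b : Fin n)
    (ε : ℝ) (I : Fin k → Fin n) (hb : b ∉ Set.range I) :
    ((addRow A a b ε).submatrix I id).det = (A.submatrix I id).det := by
  congr 1
  ext i j
  have : I i ≠ b := fun h => hb ⟨i, h⟩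
  simp [addRow, Matrix.updateRow_ne this]

theorem det_submatrix_addRow {n k : ℕ} (A : Matrix (Fin n) (Fin k) ℝ) (a b : Fin n)
    (ε : ℝ) (I : Fin k → Fin n) (hI : I.Injective) (q : Fin k) (hq : I q = b) :
    ((addRow A a b ε).submatrix I id).det =
      (A.submatrix I id).det + ε * (A.submatrix (Function.update I q a) id).det := by
  have h1 : (addRow A a b ε).submatrix I id =
      (A.submatrix I id).updateRow q (A b + ε • A a) := by
    ext i j
    by_cases hi : i = q
    · subst hi
      simp [addRow, hq]
    · have : I i ≠ b := fun h => hi (hI (h.trans hq.symm))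
      simp [addRow, Matrix.updateRow_ne this, Matrix.updateRow_ne hi]
  have h2 : (A.submatrix I id).updateRow q (A b) = A.submatrix I id := by
    ext i j
    by_cases hi : i = q
    · subst hi
      simp [hq]
    · simp [hi]
  have h3 : (A.submatrix I id).updateRow q (A a) = A.submatrix (Function.update I q a) id := by
    ext i j
    by_cases hi : i = q
    · subst hi
      simp
    · simp [hi]
  rw [h1, Matrix.det_updateRow_add, Matrix.det_updateRow_smul, h2, h3]

theorem strictMono_update_of_adjacent {n k : ℕ} (I : Fin k ↪o Fin n) (q : Fin k) (a : Fin n)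
    (hadj : (a : ℕ) + 1 = I q ∨ (I q : ℕ) + 1 = a) (ha : a ∉ Set.range I) :
    StrictMono (Function.update I q a) := by
  intro i j hij
  have h1 : ∀ r, (I r : ℕ) ≠ a := fun r h => ha ⟨r, Fin.ext h⟩
  have hi := h1 i
  have hj := h1 j
  have h2 : (I i : ℕ) < I j := I.strictMono hij
  rw [Fin.lt_def]
  rcases eq_or_ne i q with rfl | hiq
  · rw [Function.update_self, Function.update_of_ne hij.ne']
    omega
  · rcases eq_or_ne j q with rfl | hjq
    · rw [Function.update_self, Function.update_of_ne hiq]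
      omega
    · rwa [Function.update_of_ne hiq, Function.update_of_ne hjq]

/-- Adding a nonnegative multiple of a row to an adjacent row does not decrease the maximal minors
if these are nonnegative. -/
theorem minor_le_minor_addRow {n k : ℕ} (A : Matrix (Fin n) (Fin k) ℝ) (σ : ℝ)
    (hA : ∀ I : Fin k ↪o Fin n, 0 ≤ σ * (A.submatrix I id).det) {a b : Fin n}
    (hadj : (a : ℕ) + 1 = b ∨ (b : ℕ) + 1 = a) {ε : ℝ} (hε : 0 ≤ ε) (I : Fin k ↪o Fin n) :
    σ * (A.submatrix I id).det ≤ σ * ((addRow A a b ε).submatrix I id).det := by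
  by_cases hb : b ∈ Set.range I
  · obtain ⟨q, rfl⟩ := hb
    rw [det_submatrix_addRow A a _ ε I I.injective q rfl]
    -- The replaced minor has a repeated row or, by adjacency, still has its rows in increasing
    -- order, so no permutation sign appears.
    have h : 0 ≤ σ * (A.submatrix (Function.update I q a) id).det := by
      by_cases ha : a ∈ Set.range I
      · obtain ⟨r, rfl⟩ := ha
        have hrq : r ≠ q := by
          rintro rfl
          omega
        rw [Matrix.det_zero_of_row_eq hrq, mul_zero]
        ext j
        simp [hrq]
      · exact hA (OrderEmbedding.ofStrictMono _ (strictMono_update_of_adjacent I q a hadj ha))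
    nlinarith [mul_nonneg hε h]
  · rw [det_submatrix_addRow_of_notMem A a b ε I hb]

/-- Two distinct increasing tuples can be brought closer by moving one entry by one. -/
theorem exists_adjacent_update {n k : ℕ} (I J : Fin k ↪o Fin n) (hIJ : I ≠ J) :
    ∃ (q : Fin k) (b : Fin n), ((b : ℕ) + 1 = I q ∨ (I q : ℕ) + 1 = b) ∧ b ∉ Set.range I ∧
      ∑ s, |((Function.update I q b s : Fin n) : ℤ) - (J s : ℕ)| <
        ∑ s, |((I s : ℕ) : ℤ) - (J s : ℕ)| := by
  have key : ∃ (q : Fin k) (b : Fin n), ((b : ℕ) + 1 = I q ∨ (I q : ℕ) + 1 = b) ∧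
      b ∉ Set.range I ∧ |((b : ℕ) : ℤ) - (J q : ℕ)| < |((I q : ℕ) : ℤ) - (J q : ℕ)| := by
    by_cases h : ∃ q, I q < J q
    · obtain ⟨q, hq, hmax⟩ := Finset.exists_max_image (Finset.univ.filter fun q => I q < J q) id
        (by simpa [Finset.Nonempty] using h)
      simp only [Finset.mem_filter, Finset.mem_univ, true_and, id] at hq hmax
      have hq' : (I q : ℕ) < J q := hq
      refine ⟨q, ⟨I q + 1, by omega⟩, Or.inr rfl, ?_, ?_⟩
      · rintro ⟨r, hr⟩
        have hr' : (I r : ℕ) = I q + 1 := congrArg Fin.val hr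
        have h1 : q < r := I.lt_iff_lt.1 (by rw [Fin.lt_def]; omega)
        have h2 : (J q : ℕ) < J r := J.strictMono h1
        exact absurd (hmax r (by rw [Fin.lt_def]; omega)) (not_le.2 h1)
      · simp only [Nat.cast_add, Nat.cast_one]
        rw [abs_lt, abs_of_neg (by omega)]
        omega
    · have h' : ∃ q, J q < I q := by
        by_contra h'
        push Not at h h'
        exact hIJ (RelEmbedding.ext fun q => le_antisymm (h' q) (h q))
      obtain ⟨q, hq, hmin⟩ := Finset.exists_min_image (Finset.univ.filter fun q => J q < I q) id
        (by simpa [Finset.Nonempty] using h')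
      simp only [Finset.mem_filter, Finset.mem_univ, true_and, id] at hq hmin
      have hq' : (J q : ℕ) < I q := hq
      refine ⟨q, ⟨I q - 1, by omega⟩, Or.inl (by simp; omega), ?_, ?_⟩
      · rintro ⟨r, hr⟩
        have hr' : (I r : ℕ) = I q - 1 := congrArg Fin.val hr
        have h1 : r < q := I.lt_iff_lt.1 (by rw [Fin.lt_def]; omega)
        have h2 : (J r : ℕ) < J q := J.strictMono h1
        exact absurd (hmin r (by rw [Fin.lt_def]; omega)) (not_le.2 h1)
      · rw [abs_lt, abs_of_pos (a := ((I q : ℕ) : ℤ) - (J q : ℕ)) (by omega)]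
        simp only
        omega
  obtain ⟨q, b, h1, h2, h3⟩ := key
  refine ⟨q, b, h1, h2, Finset.sum_lt_sum (fun s _ => ?_) ⟨q, Finset.mem_univ _, by simpa using h3⟩⟩
  rcases eq_or_ne s q with rfl | hs
  · simpa using h3.le
  · simp [hs]

open Matrix in
-- Alternation is finitely many strict inequalities, continuous in `ε` and true at `ε = 0`.
theorem exists_pos_alternating_addRow {n k l : ℕ} (A : Matrix (Fin n) (Fin k) ℝ) (c : Fin k → ℝ)
    (t : Fin l ↪o Fin n) (ht : AlternatesOn (A *ᵥ c) t) (a b : Fin n) :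
    ∃ ε : ℝ, 0 < ε ∧ AlternatesOn (addRow A a b ε *ᵥ c) t := by
  obtain ⟨τ, hτ⟩ := ht
  have h1 : ∀ ε i, (addRow A a b ε *ᵥ c) i =
      (A *ᵥ c) i + ε * (if i = b then (A *ᵥ c) a else 0) := by
    intro ε i
    rcases eq_or_ne i b with rfl | hi
    · simp [addRow, mulVec, dotProduct, add_mul, Finset.sum_add_distrib, Finset.mul_sum, mul_assoc]
    · simp [addRow, mulVec, hi]
  have h2 : ∀ p : Fin l, ∀ᶠ ε : ℝ in nhds 0,
      0 < τ * (-1) ^ (p : ℕ) * (addRow A a b ε *ᵥ c) (t p) := by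
    intro p
    simp only [h1]
    refine ContinuousAt.eventually_lt (f := fun _ => (0 : ℝ)) (by fun_prop) (by fun_prop) ?_
    simpa using hτ p
  have h3 := (Filter.eventually_all.2 h2).filter_mono (nhdsWithin_le_nhds (s := Set.Ioi (0 : ℝ)))
  obtain ⟨ε, hε, hpos⟩ := (h3.and self_mem_nhdsWithin).exists
  exact ⟨ε, hpos, τ, hε⟩

open Matrix in
/-- If the maximal minors of `A` are nonnegative up to a common sign and not all zero, then no
vector in the column space of `A` alternates on more than `k` indices. -/
theorem not_alternatesOn_of_minors {n k : ℕ} (A : Matrix (Fin n) (Fin k) ℝ) (σ : ℝ)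
    (hA : ∀ I : Fin k ↪o Fin n, 0 ≤ σ * (A.submatrix I id).det) (I : Fin k ↪o Fin n)
    (hI : 0 < σ * (A.submatrix I id).det) (c : Fin k → ℝ) (t : Fin (k + 1) ↪o Fin n) :
    ¬ AlternatesOn (A *ᵥ c) t := by
  -- Induction on the distance from `I` to `t` without its first index; at distance zero the `p = 0`
  -- term of the relation is strictly positive.
  obtain ⟨N, hN⟩ : ∃ N : ℕ,
      ∑ s, |((I s : ℕ) : ℤ) - (((Fin.succAboveOrderEmb 0).trans t s : Fin n) : ℕ)| ≤ N :=
    ⟨_, Int.self_le_toNat _⟩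
  induction N generalizing A I with
  | zero =>
    rintro ⟨τ, hτ⟩
    have hIt : I = (Fin.succAboveOrderEmb 0).trans t := by
      refine RelEmbedding.ext fun s => Fin.ext ?_
      have h0 := Finset.sum_eq_zero_iff_of_nonneg (fun s _ => abs_nonneg _) |>.1
        (le_antisymm hN (Finset.sum_nonneg fun s _ => abs_nonneg _)) s (Finset.mem_univ s)
      rw [abs_eq_zero] at h0
      omega
    have h1 := sum_alternating_minors_eq_zero (A.submatrix t id) c
    have h2 : ∀ p : Fin (k + 1), 0 ≤
        (τ * (-1) ^ (p : ℕ) * (A *ᵥ c) (t p)) *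
          (σ * (A.submatrix ((Fin.succAboveOrderEmb p).trans t) id).det) :=
      fun p => mul_nonneg (hτ p).le (hA _)
    have h3 : 0 < ∑ p : Fin (k + 1), (τ * (-1) ^ (p : ℕ) * (A *ᵥ c) (t p)) *
          (σ * (A.submatrix ((Fin.succAboveOrderEmb p).trans t) id).det) :=
      Finset.sum_pos' (fun p _ => h2 p) ⟨0, Finset.mem_univ _, mul_pos (hτ 0) (hIt ▸ hI)⟩
    have h4 : ∑ p : Fin (k + 1), (τ * (-1) ^ (p : ℕ) * (A *ᵥ c) (t p)) *
          (σ * (A.submatrix ((Fin.succAboveOrderEmb p).trans t) id).det) =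
        τ * σ * ∑ p : Fin (k + 1), (-1) ^ (p : ℕ) * (A.submatrix t id *ᵥ c) p *
          ((A.submatrix t id).submatrix p.succAbove id).det := by
      rw [Finset.mul_sum]
      refine Finset.sum_congr rfl fun p _ => ?_
      have : (A.submatrix t id).submatrix p.succAbove id =
        A.submatrix ((Fin.succAboveOrderEmb p).trans t) id := rfl
      rw [this, show (A.submatrix t id *ᵥ c) p = (A *ᵥ c) (t p) from rfl]
      ring
    rw [h4, h1, mul_zero] at h3
    exact lt_irrefl _ h3
  | succ N ih =>
    intro ht
    by_cases hIt : I = (Fin.succAboveOrderEmb 0).trans t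
    · refine ih A hA I hI ?_ ht
      rw [← hIt]
      simp
    · obtain ⟨q, b, hadj, hb, hlt⟩ := exists_adjacent_update I _ hIt
      obtain ⟨ε, hε, halt⟩ := exists_pos_alternating_addRow A c t ht (I q) b
      have hmono := strictMono_update_of_adjacent I q b hadj hb
      have hle := minor_le_minor_addRow A σ hA (a := I q) (b := b) hadj.symm hε.le
      refine ih (addRow A (I q) b ε) (fun I' => (hA I').trans (hle I'))
        (OrderEmbedding.ofStrictMono _ hmono) ?_ ?_ halt
      · rw [OrderEmbedding.coe_ofStrictMono,
          det_submatrix_addRow A (I q) b ε _ hmono.injective q (by simp)]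
        have h1 := hA (OrderEmbedding.ofStrictMono _ hmono)
        rw [OrderEmbedding.coe_ofStrictMono] at h1
        -- Undoing the update gives back `I`, so the new minor is the old one there plus `ε` times
        -- the nonzero minor at `I`.
        simp only [Function.update_idem, Function.update_eq_self]
        nlinarith [mul_pos hε hI]
      · rw [OrderEmbedding.coe_ofStrictMono]
        push_cast at hN
        omega

/-! ### Minors of opposite signs force alternation -/

theorem exists_pos_sum_mul_eq_zero {ι : Type*} [Fintype ι] [DecidableEq ι] (d : ι → ℝ) {a b : ι}
    (ha : 0 < d a) (hb : d b < 0) : ∃ y : ι → ℝ, (∀ p, 0 < y p) ∧ ∑ p, d p * y p = 0 := by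
  have key : ∀ e : ι, ∀ r : ℝ, 0 ≤ r → r * d e = -∑ p, d p →
      ∃ y : ι → ℝ, (∀ p, 0 < y p) ∧ ∑ p, d p * y p = 0 := by
    intro e r hr he
    -- The all-ones vector is raised at one coordinate, where `d` has the sign opposite to its
    -- total.
    refine ⟨fun p => 1 + if p = e then r else 0, fun p => ?_, ?_⟩
    · dsimp only
      split_ifs <;> linarith
    · simp only [mul_add, mul_one, Finset.sum_add_distrib, mul_ite, mul_zero,
        Finset.sum_ite_eq', Finset.mem_univ, if_true]
      linarith
  rcases le_total 0 (∑ p, d p) with h | h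
  · exact key b ((∑ p, d p) / (-d b)) (div_nonneg h (by linarith))
      (by rw [div_neg, neg_mul, div_mul_cancel₀ _ hb.ne])
  · exact key a (-(∑ p, d p) / d a) (div_nonneg (by linarith) ha.le) (by field_simp)

theorem exists_succAbove_of_map_eq_erase {n k : ℕ} (I : Fin k ↪o Fin n) (t : Fin (k + 1) ↪o Fin n)
    (p : Fin (k + 1))
    (h : Finset.univ.map I.toEmbedding = (Finset.univ.map t.toEmbedding).erase (t p)) :
    I = (Fin.succAboveOrderEmb p).trans t := by
  refine RelEmbedding.ext fun s => congrFun ((StrictMono.range_inj I.strictMono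
    (t.strictMono.comp (Fin.strictMono_succAbove p))).1 ?_) s
  have h1 := congrArg (fun S : Finset (Fin n) => (S : Set (Fin n))) h
  simp only [Finset.coe_map, Finset.coe_univ, Set.image_univ, Finset.coe_erase] at h1
  have h2 : Set.range (t ∘ p.succAbove) = Set.range t \ {t p} := by
    rw [Set.range_comp, Fin.range_succAbove,
      Set.image_compl_eq_range_sdiff_image t.injective, Set.image_singleton]
  rw [h2]
  exact h1

open Matrix in
theorem exists_alternatesOn_of_adjacent_minors {n k : ℕ} (A : Matrix (Fin n) (Fin k) ℝ)
    (I I' : Fin k ↪o Fin n) (hI : 0 < (A.submatrix I id).det) (hI' : (A.submatrix I' id).det < 0)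
    (hd : (Finset.univ.map I.toEmbedding \ Finset.univ.map I'.toEmbedding).card = 1) :
    ∃ (c : Fin k → ℝ) (t : Fin (k + 1) ↪o Fin n), AlternatesOn (A *ᵥ c) t := by
  set S := Finset.univ.map I.toEmbedding with hS
  set S' := Finset.univ.map I'.toEmbedding with hS'
  have hcS : S.card = k := by simp [hS]
  have hcS' : S'.card = k := by simp [hS']
  have hd' : (S' \ S).card = 1 := by
    rw [← Finset.card_sdiff_comm (hcS.trans hcS'.symm), hd]
  obtain ⟨a, ha⟩ := Finset.card_eq_one.1 hd
  obtain ⟨b, hb⟩ := Finset.card_eq_one.1 hd'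
  have hcT : (S ∪ S').card = k + 1 := by
    rw [← Finset.sdiff_union_self_eq_union, Finset.card_union_of_disjoint Finset.sdiff_disjoint]
    omega
  let t : Fin (k + 1) ↪o Fin n := (S ∪ S').orderEmbOfFin hcT
  have ht : Finset.univ.map t.toEmbedding = S ∪ S' := by
    simp [t]
  have hmem : ∀ x, (x ∈ S ∧ x ∉ S' ↔ x = a) ∧ (x ∈ S' ∧ x ∉ S ↔ x = b) := fun x => by
    rw [← Finset.mem_sdiff, ← Finset.mem_sdiff, ha, hb]
    simp
  have hSb : S = (S ∪ S').erase b := by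
    ext x
    have := hmem x
    simp only [Finset.mem_erase, Finset.mem_union]
    tauto
  have hSa : S' = (S ∪ S').erase a := by
    ext x
    have := hmem x
    simp only [Finset.mem_erase, Finset.mem_union]
    tauto
  have hex : ∀ x ∈ S ∪ S', ∃ p, t p = x := fun x hx => by
    rw [← ht] at hx
    simpa using hx
  obtain ⟨p, hp⟩ := hex a (Finset.mem_union_left _ ((hmem a).1.2 rfl).1)
  obtain ⟨q, hq⟩ := hex b (Finset.mem_union_right _ ((hmem b).2.2 rfl).1)
  have hIq := exists_succAbove_of_map_eq_erase I t q (by rw [ht, hq]; exact hSb)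
  have hIp := exists_succAbove_of_map_eq_erase I' t p (by rw [ht, hp]; exact hSa)
  let d : Fin (k + 1) → ℝ := fun r => ((A.submatrix t id).submatrix r.succAbove id).det
  have hdq : 0 < d q := by rw [hIq] at hI; exact hI
  have hdp : d p < 0 := by rw [hIp] at hI'; exact hI'
  obtain ⟨y, hy, hsum⟩ := exists_pos_sum_mul_eq_zero d hdq hdp
  have hsq : ∀ r : Fin (k + 1), (-1 : ℝ) ^ (r : ℕ) * (-1) ^ (r : ℕ) = 1 := fun r => by
    rw [← mul_pow]
    simp
  obtain ⟨c, hc⟩ := exists_mulVec_eq_of_sum_alternating_minors (A.submatrix t id)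
    (fun r => (-1) ^ (r : ℕ) * y r) (by
      rw [← hsum]
      refine Finset.sum_congr rfl fun r _ => ?_
      rw [← mul_assoc, hsq, one_mul, mul_comm]) ⟨q, hdq.ne'⟩
  refine ⟨c, t, 1, fun r => ?_⟩
  have : (A *ᵥ c) (t r) = (-1) ^ (r : ℕ) * y r := congrFun hc r
  rw [this, one_mul, ← mul_assoc, hsq, one_mul]
  exact hy r

/-- Basis exchange for the rows of a matrix. -/
theorem exists_det_update_ne_zero {n k : ℕ} (A : Matrix (Fin n) (Fin k) ℝ)
    (I I' : Fin k → Fin n) (hI : (A.submatrix I id).det ≠ 0) (hI' : (A.submatrix I' id).det ≠ 0)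
    (q : Fin k) : ∃ j, (A.submatrix (Function.update I q (I' j)) id).det ≠ 0 := by
  by_contra! h
  have hu : IsUnit (A.submatrix I' id) := (Matrix.isUnit_iff_isUnit_det _).2 (isUnit_iff_ne_zero.2 hI')
  obtain ⟨w, hw⟩ := (Matrix.vecMul_surjective_iff_isUnit.2 hu) (A (I q))
  -- The determinant is linear in row `q`; expanding that row in the basis `I'` would make it
  -- vanish.
  let φ : (Fin k → ℝ) →ₗ[ℝ] ℝ :=
    (Matrix.detRowAlternating (R := ℝ) (n := Fin k)).toMultilinearMap.toLinearMap
      (A.submatrix I id) q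
  have hφ : ∀ x, φ (A x) = (A.submatrix (Function.update I q x) id).det := by
    intro x
    change Matrix.det ((A.submatrix I id).updateRow q (A x)) = _
    congr 1
    ext i j
    by_cases hi : i = q
    · subst hi
      simp
    · simp [hi]
  refine hI ?_
  have h1 : (A.submatrix I id).det = φ (A (I q)) := by simp [hφ]
  have hw' : A (I q) = ∑ j, w j • A (I' j) := by
    rw [← hw]
    exact Matrix.vecMul_eq_sum _ _
  rw [h1, hw', map_sum]
  refine Finset.sum_eq_zero fun j _ => ?_
  rw [map_smul, hφ, h, smul_zero]

open Matrix in
theorem exists_alternatesOn_of_minors {n k : ℕ} (A : Matrix (Fin n) (Fin k) ℝ)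
    (I I' : Fin k ↪o Fin n) (hI : 0 < (A.submatrix I id).det)
    (hI' : (A.submatrix I' id).det < 0) :
    ∃ (c : Fin k → ℝ) (t : Fin (k + 1) ↪o Fin n), AlternatesOn (A *ᵥ c) t := by
  obtain ⟨d, hd⟩ : ∃ d, (Finset.univ.map I.toEmbedding \ Finset.univ.map I'.toEmbedding).card = d :=
    ⟨_, rfl⟩
  induction d generalizing I with
  | zero =>
    rw [Finset.card_eq_zero, Finset.sdiff_eq_empty_iff_subset] at hd
    have h1 := Finset.eq_of_subset_of_card_le hd (by simp)
    have h2 : I = I' := RelEmbedding.ext fun s => congrFun ((StrictMono.range_inj I.strictMono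
      I'.strictMono).1 (by simpa using congrArg (fun S : Finset (Fin n) => (S : Set (Fin n))) h1)) s
    rw [h2] at hI
    exact absurd hI hI'.not_gt
  | succ d ih =>
    obtain ⟨a, ha⟩ : (Finset.univ.map I.toEmbedding \ Finset.univ.map I'.toEmbedding).Nonempty := by
      rw [← Finset.card_pos]
      omega
    have ha' := Finset.mem_sdiff.1 ha
    obtain ⟨q, -, hq⟩ := Finset.mem_map.1 ha'.1
    have haI' : ∀ r, I' r ≠ a := fun r hr => ha'.2 (Finset.mem_map.2 ⟨r, Finset.mem_univ _, hr⟩)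
    obtain ⟨j, hj⟩ := exists_det_update_ne_zero A I I' hI.ne' hI'.ne q
    have hjI : ∀ r, I r ≠ I' j := by
      intro r hr
      rcases eq_or_ne r q with rfl | hrq
      · exact haI' j (hr.symm.trans hq)
      · refine hj (Matrix.det_zero_of_row_eq hrq ?_)
        ext s
        simp [hrq, hr]
    have hinj : Function.Injective (Function.update I q (I' j)) := by
      intro r s hrs
      by_cases hr : r = q <;> by_cases hs : s = q
      · rw [hr, hs]
      · subst hr
        simp only [Function.update_self, Function.update_of_ne hs] at hrs
        exact absurd hrs.symm (hjI s)
      · subst hs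
        simp only [Function.update_self, Function.update_of_ne hr] at hrs
        exact absurd hrs (hjI r)
      · simp only [Function.update_of_ne hr, Function.update_of_ne hs] at hrs
        exact I.injective hrs
    obtain ⟨K, hK⟩ := exists_orderEmbedding_range_eq _ hinj
    have hKdet := det_submatrix_ne_zero_of_range_eq A hinj hK hj
    have hKmem : ∀ x, x ∈ Finset.univ.map K.toEmbedding ↔
        x = I' j ∨ (x ∈ Finset.univ.map I.toEmbedding ∧ x ≠ a) := by
      intro x
      have h1 : x ∈ Finset.univ.map K.toEmbedding ↔ x ∈ Set.range K := by simp
      rw [h1, hK]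
      constructor
      · rintro ⟨r, rfl⟩
        rcases eq_or_ne r q with rfl | hr
        · exact Or.inl (by simp)
        · refine Or.inr ⟨by simp [hr], ?_⟩
          rw [Function.update_of_ne hr, ← hq]
          exact fun h => hr (I.injective h)
      · rintro (rfl | ⟨hx, hxa⟩)
        · exact ⟨q, by simp⟩
        · obtain ⟨r, -, rfl⟩ := Finset.mem_map.1 hx
          exact ⟨r, Function.update_of_ne (fun h => hxa (by rw [h]; exact hq)) _ _⟩
    have hjI' : I' j ∈ Finset.univ.map I'.toEmbedding := by simp
    -- A negative minor at `K` gives the adjacent pair `I`, `K`; a positive one lets `K` replace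
    -- `I`, one row closer to `I'`.
    rcases lt_or_gt_of_ne hKdet with h | h
    · refine exists_alternatesOn_of_adjacent_minors A I K hI h (Finset.card_eq_one.2 ⟨a, ?_⟩)
      ext x
      rw [Finset.mem_sdiff, hKmem, Finset.mem_singleton]
      constructor
      · rintro ⟨h1, h2⟩
        by_contra hxa
        exact h2 (Or.inr ⟨h1, hxa⟩)
      · rintro rfl
        exact ⟨ha'.1, fun h => h.elim (fun h => haI' j h.symm) fun h => h.2 rfl⟩
    · refine ih K h ?_
      have h1 : Finset.univ.map K.toEmbedding \ Finset.univ.map I'.toEmbedding =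
          (Finset.univ.map I.toEmbedding \ Finset.univ.map I'.toEmbedding).erase a := by
        ext x
        rw [Finset.mem_sdiff, hKmem, Finset.mem_erase, Finset.mem_sdiff]
        constructor
        · rintro ⟨rfl | h1, h2⟩
          · exact absurd hjI' h2
          · exact ⟨h1.2, h1.1, h2⟩
        · rintro ⟨h1, h2, h3⟩
          exact ⟨Or.inr ⟨h2, h1⟩, h3⟩
      rw [h1, Finset.card_erase_of_mem ha, hd]
      rfl

/-! ### The equivalence -/

open Matrix in
theorem exists_mulVec_eq_submatrix_mulVec {n m k : ℕ} (X : Matrix (Fin n) (Fin m) ℝ)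
    (J : Fin k → Fin m) (c : Fin k → ℝ) : ∃ u, X *ᵥ u = X.submatrix id J *ᵥ c := by
  have h : X.submatrix id J *ᵥ c ∈ LinearMap.range X.mulVecLin := by
    have h1 : X.submatrix id J *ᵥ c = ∑ j, c j • X.col (J j) := by
      ext i
      simp [mulVec, dotProduct, mul_comm]
    rw [h1, range_mulVecLin]
    exact Submodule.sum_mem _ fun j _ =>
      Submodule.smul_mem _ _ (Submodule.subset_span (Set.mem_range_self (J j)))
  exact h

theorem mainTheorem5 (n m k : ℕ) (X : Matrix (Fin n) (Fin m) ℝ)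
    (hnm : m < n) (hrank : X.rank = k) (hkm : k < m) :
    (∀ J : Fin k ↪o Fin m,
        (∀ I : Fin k ↪o Fin n, 0 ≤ compoundMatrix X k I J) ∨
        (∀ I : Fin k ↪o Fin n, compoundMatrix X k I J ≤ 0)) ↔
      (∀ u : Fin m → ℝ, signVariation (X.mulVec u) ≤ (k : ℤ) - 1) := by
  have hC : ∀ I J, compoundMatrix X k I J = ((X.submatrix id J).submatrix I id).det :=
    fun _ _ => rfl
  constructor
  · intro h u
    by_contra hu
    obtain ⟨t, ht⟩ := (natCast_le_signVariation_iff (k := k) (X.mulVec u)).1 (by omega)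
    rw [Matrix.rank_eq_finrank_span_cols] at hrank
    obtain ⟨J, hli, hspan⟩ := exists_orderEmbedding_linearIndependent _ hrank
    obtain ⟨I, hI⟩ := exists_det_submatrix_ne_zero (X.submatrix id J) hli
    obtain ⟨c, hc⟩ : ∃ c, (X.submatrix id J).mulVec c = X.mulVec u := by
      have h1 : X.mulVec u ∈ LinearMap.range (X.submatrix id J).mulVecLin := by
        rw [Matrix.range_mulVecLin]
        refine hspan.ge ?_
        rw [← Matrix.range_mulVecLin]
        exact LinearMap.mem_range_self X.mulVecLin u
      exact h1
    rw [← hc] at ht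
    simp only [hC] at h
    rcases h J with h | h
    · exact not_alternatesOn_of_minors _ 1 (fun I => by simpa using h I) I
        (by simpa using lt_of_le_of_ne (h I) hI.symm) c t ht
    · exact not_alternatesOn_of_minors _ (-1) (fun I => by simpa using h I) I
        (by simpa using lt_of_le_of_ne (h I) hI) c t ht
  · intro h J
    by_contra! hneg
    obtain ⟨⟨I', hI'⟩, I, hI⟩ := hneg
    obtain ⟨c, t, ht⟩ := exists_alternatesOn_of_minors (X.submatrix id J) I I' hI hI'
    obtain ⟨u, hu⟩ := exists_mulVec_eq_submatrix_mulVec X J c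
    rw [← hu] at ht
    have h1 := (natCast_le_signVariation_iff (X.mulVec u)).2 ⟨t, ht⟩
    have h2 := h u
    omega
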